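/- **Setting.** Let $n$ nodes be partitioned into $K_*$ nonempty communities; write $i(u)$ for the community of node $u$. A Normal LSM (linear sociability model) network is the random symmetric $n\times n$ matrix $A$ with zero diagonal and, for $u\neq v$ with $i=i(u)$, $j=i(v)$, $$A_{uv}=\gamma_{ij}+\alpha_{ij}Z_u+\beta_{ij}Z_v+\sigma_{ij}\epsilon_{uv},$$ where $\gamma_{ij}=\gamma_{ji}$, $\beta_{ij}=\alpha_{ji}$ are real, $\sigma_{ij}=\sigma_{ji}\ge 0$, $\epsilon_{uv}=\epsilon_{vu}$, and the variables $Z_u$ (one for each node) and $\epsilon_{uv}$ (one for each unordered pair $u\ne v$) are independent $\mathcal N(0,1)$. Let $P_*$ be the network given by the same formula with every $\sigma_{ij}$ replaced by $0$, and let $\sigma_{\max}^2$ be the largest value of $\sigma_{i(u)i(v)}^2$ over $u\ne v$. For a clustering of the nodes into $\hat K$ nonempty clusters, the induced estimate $\hat P$ is the matrix closest to $A$ in Frobenius norm among all symmetric matrices with zero diagonal whose entries are, for $u\ne v$, $u$ in cluster $k$ and $v$ in cluster $l$, of the form $\hat\gamma_{kl}+\hat\alpha_{kl}\hat Z^{(k,l)}_u+\hat\beta_{kl}\hat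 Z^{(l,k)}_v$ with $\hat\gamma_{kl}=\hat\gamma_{lk}$, $\hat\beta_{kl}=\hat\alpha_{lk}$ (the estimated sociabilities of a node may depend on the pair of clusters). For constants $C_1,C_2,C_3>0$ and $0<c<1$ put $$\mathrm{Pen}(n,K)=6\sigma_{\max}^2\left(C_1nK+C_2K^2\log n\right)+\left(6C_3+\tfrac2c\right)\sigma_{\max}^2\left(\log n+n\log K\right).$$ Now let $\hat P$ be the estimate induced by a clustering, among all clusterings into any number $\hat K$ of nonempty clusters, that minimizes $\|A-\hat P\|_F^2+\mathrm{Pen}(n,\hat K)$. **Theorem.** There is an absolute constant $C_0>0$ such that the following holds for all $C_1,C_2\ge C_0$, all $0<c<1$, all $C_3\ge C_0/c$, all $n$, $K_*$ and all Normal LSM networks as above. A minimizing clustering exists for every realization of $A$, and for every $t>0$, with probability at least $1-3e^{-t}$, every minimizing $\hat P$ satisfies $$\|\hat P-P_*\|_F^2\le(1-c)^{-1}\,\mathrm{Pen}(n,K_*)+\frac{C_0}{c}\,\sigma_{\max}^2\,t .$$ In particular, since $C_3 \ge C_0$, the same bound holds with $C_3$ in place of $C_0$. -/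

import Mathlib

open MeasureTheory ProbabilityTheory
open scoped Matrix.Norms.Frobenius

/-- The deterministic part of a Normal linear sociability model on `n` nodes with `K` communities:
the community of every node (no community is empty) and, for every ordered pair of communities
`(i, j)`, the coefficients of the edge weights between a node of `i` and a node of `j`. Edges are
undirected, so reading an edge from either of its ends must give the same weight: this is what
`γ_symm`, `β_eq` and `σ_symm` say (in particular `α i i = β i i`). -/
structure NormalLSM (n K : ℕ) where
  /-- the community of each node -/
  label : Fin n → Fin K
  label_surjective : Function.Surjective label
  γ : Fin K → Fin K → ℝ
  α : Fin K → Fin K → ℝ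
  β : Fin K → Fin K → ℝ
  σ : Fin K → Fin K → ℝ
  γ_symm : ∀ i j, γ i j = γ j i
  β_eq : ∀ i j, β i j = α j i
  σ_symm : ∀ i j, σ i j = σ j i
  σ_nonneg : ∀ i j, 0 ≤ σ i j

namespace NormalLSM

variable {n K : ℕ}

/-- The same generating process with every `σ` set to `0`. -/
def noiseFree (θ : NormalLSM n K) : NormalLSM n K :=
  { θ with
    σ := fun _ _ => 0
    σ_symm := fun _ _ => rfl
    σ_nonneg := fun _ _ => le_rfl }

/-- The weighted adjacency matrix generated from the node sociabilities `Z` and the edge errors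
`ε` (indexed by unordered pairs of nodes): no self-loops, and for `u ≠ v` with `u` in community
`i` and `v` in community `j` the weight is `γ i j + α i j * Z u + β i j * Z v + σ i j * ε {u, v}`. -/
def network (θ : NormalLSM n K) (Z : Fin n → ℝ) (ε : Sym2 (Fin n) → ℝ) :
    Matrix (Fin n) (Fin n) ℝ :=
  Matrix.of fun u v =>
    if u = v then 0
    else θ.γ (θ.label u) (θ.label v) + θ.α (θ.label u) (θ.label v) * Z u
      + θ.β (θ.label u) (θ.label v) * Z v + θ.σ (θ.label u) (θ.label v) * ε s(u, v)

/-- The largest variance parameter over all the edges of the network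
(`0` if there is no edge at all, that is, if `n ≤ 1`). -/
noncomputable def sigmaMaxSq (θ : NormalLSM n K) : ℝ :=
  ⨆ e : {e : Fin n × Fin n // e.1 ≠ e.2}, θ.σ (θ.label e.1.1) (θ.label e.1.2) ^ 2

end NormalLSM

/-- The node sociabilities `Z u` and the errors `ε e`, `e` ranging over the edges (unordered pairs
of distinct nodes), are independent standard normal random variables. -/
structure IsStandardNormalInput {Ω : Type*} [MeasurableSpace Ω] (μ : Measure Ω) {n : ℕ}
    (Z : Fin n → Ω → ℝ) (ε : Sym2 (Fin n) → Ω → ℝ) : Prop where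
  law_Z : ∀ u, HasLaw (Z u) (gaussianReal 0 1) μ
  law_ε : ∀ e : Sym2 (Fin n), ¬ e.IsDiag → HasLaw (ε e) (gaussianReal 0 1) μ
  indep : iIndepFun
    (Sum.elim Z (fun e : {e : Sym2 (Fin n) // ¬ e.IsDiag} => ε e.1)) μ

/-- `P` is a noise-free network of Normal LSM form with respect to the clustering `z`: between
each pair of clusters `(k, l)` it is given by coefficients `γ k l`, `α k l`, `β k l` and by
sociabilities that may depend on the pair of clusters (`Z u l` is the sociability of the node `u`
towards the cluster `l`). There are no self-loops and edges are undirected. -/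
def IsNoiseFreeForm {n K : ℕ} (z : Fin n → Fin K) (P : Matrix (Fin n) (Fin n) ℝ) : Prop :=
  ∃ (γ α β : Fin K → Fin K → ℝ) (Z : Fin n → Fin K → ℝ),
    (∀ k l, γ k l = γ l k) ∧ (∀ k l, β k l = α l k) ∧
    ∀ u v, P u v =
      if u = v then 0
      else γ (z u) (z v) + α (z u) (z v) * Z u (z v) + β (z u) (z v) * Z v (z u)

/-- `P` is the network induced by the clustering `z` from the observed network `A`: among the
noise-free networks with respect to `z`, it is closest to `A` in Frobenius norm. -/
def IsInducedEstimate {n K : ℕ} (A : Matrix (Fin n) (Fin n) ℝ) (z : Fin n → Fin K)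
    (P : Matrix (Fin n) (Fin n) ℝ) : Prop :=
  IsNoiseFreeForm z P ∧ ∀ Q, IsNoiseFreeForm z Q → ‖A - P‖ ≤ ‖A - Q‖

/-- `z` is a best clustering, into `K` nonempty clusters, for the penalty `pen` (a function of the
number of clusters), and `P` is the network that it induces. -/
def IsPenalizedEstimate {n : ℕ} (pen : ℕ → ℝ) (A : Matrix (Fin n) (Fin n) ℝ) (K : ℕ)
    (z : Fin n → Fin K) (P : Matrix (Fin n) (Fin n) ℝ) : Prop :=
  Function.Surjective z ∧ IsInducedEstimate A z P ∧
    ∀ (K' : ℕ) (z' : Fin n → Fin K') (P' : Matrix (Fin n) (Fin n) ℝ),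
      Function.Surjective z' → IsInducedEstimate A z' P' →
        ‖A - P‖ ^ 2 + pen K ≤ ‖A - P'‖ ^ 2 + pen K'

/-- The penalty for `K` communities on `n` nodes; `s` is the largest variance parameter. -/
noncomputable def penalty (C₁ C₂ C₃ c s : ℝ) (n K : ℕ) : ℝ :=
  6 * s * (C₁ * n * K + C₂ * (K : ℝ) ^ 2 * Real.log n)
    + (6 * C₃ + 2 / c) * s * (Real.log n + n * Real.log K)

/-! ### Tail bounds for Gaussian vectors. -/

section GaussianTails

/-! For a fixed clustering `z` into `K` clusters the noise-free networks form a linear space `V` of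
dimension at most `n * K`, and the induced estimate is the orthogonal projection of `A = P_* + W` on
`V` (`isInducedEstimate_iff`). Comparing the penalized criterion with its value at `P_*` gives, with
`r = P_* - Π P_*`, a bound of the squared error by `2‖ΠW‖² + 2|⟨W, r⟩| + pen K_* - pen K`, and also
by Pythagoras `‖r‖ ≤ ‖P̂ - P_*‖` (`norm_sq_le_of_penalized`).

The noise `W` is Gaussian with covariance at most `2 σ_max²`, and independent of `r`, which depends
on `Z` only. So for each `z`, up to probability `3 exp (-x)`, `‖ΠW‖²` is of order `σ_max² (n K + x)`
and `|⟨W, r⟩|` is at most `√(4 σ_max² x) ‖r‖`. Since `z` is chosen from the data, a union bound over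
all clusterings is taken with `x = log n + n log K + t`. The penalty at `K` pays for everything
except `t`, and Young's inequality absorbs `‖r‖` into the error, at the price of the factor `(1 -
c)⁻¹` (`penalized_risk_bound`). -/

theorem lintegral_exp_mul_gaussianReal (a : ℝ) :
    ∫⁻ x, ENNReal.ofReal (Real.exp (a * x)) ∂(gaussianReal 0 1)
      = ENNReal.ofReal (Real.exp (a ^ 2 / 2)) := by
  rw [← ofReal_integral_eq_lintegral_ofReal (integrable_exp_mul_gaussianReal a)
    (ae_of_all _ fun x => (Real.exp_pos _).le)]
  congr 1
  have h := mgf_gaussianReal (p := gaussianReal 0 1) (X := id) (μ := 0) (v := 1)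
    (by simp) a
  simpa [mgf] using h

theorem lintegral_exp_sq_gaussianReal :
    ∫⁻ x, ENNReal.ofReal (Real.exp (x ^ 2 / 4)) ∂(gaussianReal 0 1)
      = ENNReal.ofReal (Real.sqrt 2) := by
  rw [gaussianReal_of_var_ne_zero 0 one_ne_zero,
    lintegral_withDensity_eq_lintegral_mul _ (measurable_gaussianPDF 0 1) (by fun_prop)]
  have h : ∀ x : ℝ, (gaussianPDF 0 1 * fun x => ENNReal.ofReal (Real.exp (x ^ 2 / 4))) x
      = ENNReal.ofReal ((Real.sqrt (2 * Real.pi))⁻¹ * Real.exp (-(1 / 4) * x ^ 2)) := by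
    intro x
    rw [Pi.mul_apply, gaussianPDF, ← ENNReal.ofReal_mul (gaussianPDFReal_nonneg 0 1 x),
      gaussianPDFReal, mul_assoc, ← Real.exp_add]
    simp only [NNReal.coe_one, mul_one, sub_zero]
    congr 3
    ring
  simp_rw [h]
  rw [← ofReal_integral_eq_lintegral_ofReal
    ((integrable_exp_neg_mul_sq (by norm_num)).const_mul _)
    (ae_of_all _ fun x => by positivity), integral_const_mul, integral_gaussian,
    ← Real.sqrt_inv, ← Real.sqrt_mul (by positivity)]
  congr 2
  field_simp
  norm_num

variable {ι : Type*} [Fintype ι]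

/-- The standard Gaussian measure on `ι → ℝ`. -/
noncomputable abbrev stdGaussianPi (ι : Type*) [Fintype ι] : Measure (ι → ℝ) :=
  Measure.pi fun _ => gaussianReal 0 1

theorem lintegral_prod_stdGaussianPi (f : ι → ℝ → ENNReal) (hf : ∀ i, Measurable (f i)) :
    ∫⁻ x, ∏ i, f i (x i) ∂(stdGaussianPi ι) = ∏ i, ∫⁻ x, f i x ∂(gaussianReal 0 1) := by
  have hind : iIndepFun (fun (i : ι) (x : ι → ℝ) => f i (x i)) (stdGaussianPi ι) :=
    iIndepFun_pi (X := f) (fun i => (hf i).aemeasurable)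
  rw [lintegral_prod_eq_prod_lintegral_of_indepFun Finset.univ _ hind
    (fun i => (hf i).comp (measurable_pi_apply i))]
  refine Finset.prod_congr rfl fun i _ => ?_
  exact (measurePreserving_eval (fun _ : ι => gaussianReal 0 1) i).lintegral_comp (hf i)

theorem lintegral_exp_sum_stdGaussianPi (a : ι → ℝ) :
    ∫⁻ x, ENNReal.ofReal (Real.exp (∑ i, x i * a i)) ∂(stdGaussianPi ι)
      = ENNReal.ofReal (Real.exp ((∑ i, a i ^ 2) / 2)) := by
  have h : ∀ x : ι → ℝ, ENNReal.ofReal (Real.exp (∑ i, x i * a i))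
      = ∏ i, ENNReal.ofReal (Real.exp (a i * x i)) := by
    intro x
    rw [Real.exp_sum, ENNReal.ofReal_prod_of_nonneg fun _ _ => (Real.exp_pos _).le]
    simp_rw [mul_comm]
  simp_rw [h]
  rw [lintegral_prod_stdGaussianPi (fun i x => ENNReal.ofReal (Real.exp (a i * x)))
    (fun i => by fun_prop)]
  simp_rw [lintegral_exp_mul_gaussianReal]
  rw [← ENNReal.ofReal_prod_of_nonneg fun _ _ => (Real.exp_pos _).le, ← Real.exp_sum,
    Finset.sum_div]

theorem lintegral_exp_sum_sq_stdGaussianPi :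
    ∫⁻ x, ENNReal.ofReal (Real.exp ((∑ i, x i ^ 2) / 4)) ∂(stdGaussianPi ι)
      = ENNReal.ofReal (Real.exp (Fintype.card ι * (Real.log 2 / 2))) := by
  have h : ∀ x : ι → ℝ, ENNReal.ofReal (Real.exp ((∑ i, x i ^ 2) / 4))
      = ∏ i, ENNReal.ofReal (Real.exp (x i ^ 2 / 4)) := by
    intro x
    rw [Finset.sum_div, Real.exp_sum, ENNReal.ofReal_prod_of_nonneg fun _ _ => (Real.exp_pos _).le]
  simp_rw [h]
  rw [lintegral_prod_stdGaussianPi (fun i x => ENNReal.ofReal (Real.exp (x ^ 2 / 4)))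
    (fun i => by fun_prop)]
  simp_rw [lintegral_exp_sq_gaussianReal]
  rw [Finset.prod_const, Finset.card_univ, ← ENNReal.ofReal_pow (Real.sqrt_nonneg _),
    Real.exp_nat_mul, Real.sqrt_eq_rpow, Real.rpow_def_of_pos (by norm_num)]
  congr 3
  ring

theorem measure_le_of_lintegral_exp_le {α : Type*} [MeasurableSpace α] {μ : Measure α}
    {f : α → ℝ} (hf : Measurable f) {m x : ℝ}
    (h : ∫⁻ a, ENNReal.ofReal (Real.exp (f a)) ∂μ ≤ ENNReal.ofReal (Real.exp m)) :
    μ {a | m + x ≤ f a} ≤ ENNReal.ofReal (Real.exp (-x)) := by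
  have hM := meas_ge_le_lintegral_div (μ := μ)
    (f := fun a => ENNReal.ofReal (Real.exp (f a))) (by fun_prop)
    (ε := ENNReal.ofReal (Real.exp (m + x))) (by simp [Real.exp_pos]) ENNReal.ofReal_ne_top
  refine (measure_mono ?_).trans (hM.trans ?_)
  · intro a ha
    exact ENNReal.ofReal_le_ofReal (Real.exp_le_exp.2 ha)
  · refine (ENNReal.div_le_div_right h _).trans ?_
    rw [← ENNReal.ofReal_div_of_pos (Real.exp_pos _), ← Real.exp_sub]
    exact le_of_eq (by congr 2; ring)

variable {E : Type*} [NormedAddCommGroup E] [InnerProductSpace ℝ E] {w : ι → E} {τ : ℝ}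

/-- `hw` says that the covariance operator of the Gaussian vector `∑ i, x i • w i` is at most `τ`;
this is the resulting sub-Gaussian bound. -/
theorem lintegral_exp_inner_le (hw : ∀ v, ∑ i, inner ℝ (w i) v ^ 2 ≤ τ * ‖v‖ ^ 2) (v : E) :
    ∫⁻ x, ENNReal.ofReal (Real.exp (inner ℝ (∑ i, x i • w i) v)) ∂(stdGaussianPi ι)
      ≤ ENNReal.ofReal (Real.exp (τ * ‖v‖ ^ 2 / 2)) := by
  simp_rw [sum_inner, real_inner_smul_left]
  rw [lintegral_exp_sum_stdGaussianPi]
  refine ENNReal.ofReal_le_ofReal (Real.exp_le_exp.2 ?_)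
  linarith [hw v]

/-- Tail bound for a linear functional of a Gaussian vector. -/
theorem stdGaussianPi_inner_tail (hw : ∀ v, ∑ i, inner ℝ (w i) v ^ 2 ≤ τ * ‖v‖ ^ 2) (hτ : 0 < τ)
    {x : ℝ} (hx : 0 < x) (v : E) :
    stdGaussianPi ι {y | √(2 * τ * x) * ‖v‖ < |inner ℝ (∑ i, y i • w i) v|}
      ≤ 2 * ENNReal.ofReal (Real.exp (-x)) := by
  have hmeas : ∀ u : E, Measurable fun y : ι → ℝ => inner ℝ (∑ i, y i • w i) u := by
    intro u
    simp_rw [sum_inner, real_inner_smul_left]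
    fun_prop
  rcases eq_or_ne v 0 with rfl | hv
  · simp
  have hv' : 0 < ‖v‖ := norm_pos_iff.2 hv
  set r := √(2 * τ * x) with hr
  have hr2 : r ^ 2 = 2 * τ * x := Real.sq_sqrt (by positivity)
  have hr0 : 0 < r := Real.sqrt_pos.2 (by positivity)
  -- Chernoff at the optimal slope `±r / (τ‖v‖)`: the log-moment bound equals `x` there and the
  -- threshold `r‖v‖` becomes `2x`, which leaves `exp (-x)` for each sign.
  have key : ∀ s : ℝ, s ^ 2 = (r / (τ * ‖v‖)) ^ 2 →
      stdGaussianPi ι {y | x + x ≤ inner ℝ (∑ i, y i • w i) (s • v)}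
        ≤ ENNReal.ofReal (Real.exp (-x)) := by
    intro s hs
    refine measure_le_of_lintegral_exp_le (hmeas _) ?_
    refine (lintegral_exp_inner_le hw (s • v)).trans (le_of_eq ?_)
    rw [norm_smul, mul_pow, Real.norm_eq_abs, sq_abs, hs, div_pow, hr2]
    congr 2
    field_simp
  have hsub : {y : ι → ℝ | r * ‖v‖ < |inner ℝ (∑ i, y i • w i) v|}
      ⊆ {y | x + x ≤ inner ℝ (∑ i, y i • w i) ((r / (τ * ‖v‖)) • v)}
        ∪ {y | x + x ≤ inner ℝ (∑ i, y i • w i) ((-(r / (τ * ‖v‖))) • v)} := by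
    intro y hy
    have hx2 : x + x = r / (τ * ‖v‖) * (r * ‖v‖) := by
      field_simp
      linarith
    have hp : 0 < r / (τ * ‖v‖) := by positivity
    simp only [Set.mem_ofPred_eq, Set.mem_union, inner_smul_right] at hy ⊢
    rcases lt_abs.1 hy with h | h
    · left
      rw [hx2]
      gcongr
    · right
      rw [hx2, neg_mul, ← mul_neg]
      gcongr
  refine (measure_mono hsub).trans ((measure_union_le _ _).trans ?_)
  rw [two_mul]
  exact add_le_add (key _ rfl) (key _ (by ring))

/-- Tail bound for the squared norm of the projection of a Gaussian vector. -/
theorem stdGaussianPi_starProjection_tail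
    (hw : ∀ v, ∑ i, inner ℝ (w i) v ^ 2 ≤ τ * ‖v‖ ^ 2) (hτ : 0 < τ)
    (V : Submodule ℝ E) [FiniteDimensional ℝ V] (x : ℝ) :
    stdGaussianPi ι {y | 4 * τ * (Module.finrank ℝ V * (Real.log 2 / 2) + x)
        ≤ ‖V.starProjection (∑ i, y i • w i)‖ ^ 2}
      ≤ ENNReal.ofReal (Real.exp (-x)) := by
  set d := Module.finrank ℝ V
  let b : OrthonormalBasis (Fin d) ℝ V := stdOrthonormalBasis ℝ V
  set s : ℝ := √(1 / (2 * τ)) with hs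
  have hs2 : s ^ 2 = 1 / (2 * τ) := Real.sq_sqrt (by positivity)
  have hnorm : ∀ u : E, ‖V.starProjection u‖ ^ 2 = ∑ k, inner ℝ u (b k : E) ^ 2 := by
    intro u
    have h := b.sum_sq_norm_inner_right (V.orthogonalProjectionOnto u)
    have h1 : ‖V.starProjection u‖ = ‖V.orthogonalProjectionOnto u‖ := rfl
    rw [h1, ← h]
    refine Finset.sum_congr rfl fun k _ => ?_
    rw [Real.norm_eq_abs, sq_abs, Submodule.inner_orthogonalProjectionOnto_eq_of_mem_left,
      real_inner_comm]
  have hnormb : ∀ g : Fin d → ℝ, ‖∑ k, g k • (b k : E)‖ ^ 2 = ∑ k, g k ^ 2 := by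
    intro g
    have ho : Orthonormal ℝ (fun k => (b k : E)) :=
      b.orthonormal.comp_linearIsometry V.subtypeₗᵢ
    rw [← real_inner_self_eq_norm_sq, ho.inner_sum]
    simp [sq]
  have hmeas : Measurable fun y : ι → ℝ =>
      ∑ k, inner ℝ (∑ i, y i • w i) (b k : E) ^ 2 := by
    simp_rw [sum_inner, real_inner_smul_left]
    fun_prop
  -- Gaussian linearization: `exp (‖ΠW‖² / (4τ))` is the average of `exp ⟨W, s • g⟩` over an
  -- independent standard Gaussian `g` in `V`, where `s² = 1 / (2τ)`. Integrating over `W` first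
  -- leaves `exp (‖g‖² / 4)`, of mean `√2 ^ d`.
  have hint : ∫⁻ y, ENNReal.ofReal
        (Real.exp ((∑ k, inner ℝ (∑ i, y i • w i) (b k : E) ^ 2) / (4 * τ))) ∂(stdGaussianPi ι)
      ≤ ENNReal.ofReal (Real.exp (d * (Real.log 2 / 2))) := by
    have h1 : ∀ y : ι → ℝ, ENNReal.ofReal
        (Real.exp ((∑ k, inner ℝ (∑ i, y i • w i) (b k : E) ^ 2) / (4 * τ)))
        = ∫⁻ g, ENNReal.ofReal (Real.exp
            (inner ℝ (∑ i, y i • w i) (s • ∑ k, g k • (b k : E)))) ∂(stdGaussianPi (Fin d)) := by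
      intro y
      have h2 := lintegral_exp_sum_stdGaussianPi
        (fun k => s * inner ℝ (∑ i, y i • w i) (b k : E))
      have h3 : ∀ g : Fin d → ℝ, inner ℝ (∑ i, y i • w i) (s • ∑ k, g k • (b k : E))
          = ∑ k, g k * (s * inner ℝ (∑ i, y i • w i) (b k : E)) := by
        intro g
        rw [inner_smul_right, inner_sum, Finset.mul_sum]
        refine Finset.sum_congr rfl fun k _ => ?_
        rw [inner_smul_right]
        ring
      simp_rw [h3]
      rw [h2]
      simp_rw [mul_pow]
      rw [← Finset.mul_sum, hs2]
      congr 2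
      field_simp
      norm_num
    simp_rw [h1]
    rw [lintegral_lintegral_swap]
    · calc ∫⁻ g, ∫⁻ y, ENNReal.ofReal (Real.exp
            (inner ℝ (∑ i, y i • w i) (s • ∑ k, g k • (b k : E)))) ∂(stdGaussianPi ι)
              ∂(stdGaussianPi (Fin d))
          ≤ ∫⁻ g, ENNReal.ofReal (Real.exp ((∑ k, g k ^ 2) / 4)) ∂(stdGaussianPi (Fin d)) := by
            refine lintegral_mono fun g => (lintegral_exp_inner_le hw _).trans (le_of_eq ?_)
            rw [norm_smul, mul_pow, Real.norm_eq_abs, sq_abs, hs2, hnormb]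
            congr 2
            field_simp
            ring
        _ = _ := by
            rw [lintegral_exp_sum_sq_stdGaussianPi, Fintype.card_fin]
    · simp_rw [inner_smul_right, sum_inner, real_inner_smul_left, inner_sum, inner_smul_right]
      fun_prop
  refine (measure_mono ?_).trans (measure_le_of_lintegral_exp_le (hmeas.div_const _) hint)
  intro y hy
  simp only [Set.mem_ofPred_eq] at hy ⊢
  rw [le_div_iff₀ (by positivity), ← hnorm]
  linarith

end GaussianTails

/-! ### Noise-free networks as a linear space, and the estimate as a projection. -/

section LinearAlgebra

variable {n K : ℕ}

/-- The entries of a square matrix as a Euclidean vector. -/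
noncomputable def matrixVec : Matrix (Fin n) (Fin n) ℝ ≃ₗ[ℝ] EuclideanSpace ℝ (Fin n × Fin n) where
  toFun A := WithLp.toLp 2 fun p => A p.1 p.2
  invFun v := Matrix.of fun i j => v (i, j)
  map_add' _ _ := rfl
  map_smul' _ _ := rfl
  left_inv _ := rfl
  right_inv _ := rfl

theorem matrixVec_apply (A : Matrix (Fin n) (Fin n) ℝ) (p : Fin n × Fin n) :
    matrixVec A p = A p.1 p.2 := rfl

theorem norm_matrixVec (A : Matrix (Fin n) (Fin n) ℝ) : ‖matrixVec A‖ = ‖A‖ := by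
  rw [EuclideanSpace.norm_eq, Matrix.frobenius_norm_def, Real.sqrt_eq_rpow, Fintype.sum_prod_type]
  simp [matrixVec_apply]

theorem norm_matrixVec_sub (A B : Matrix (Fin n) (Fin n) ℝ) :
    ‖matrixVec A - matrixVec B‖ = ‖A - B‖ := by
  rw [← map_sub, norm_matrixVec]

/-- The noise-free network with sociability `w u l` of node `u` towards cluster `l`. -/
noncomputable def sociabilityMap (z : Fin n → Fin K) :
    (Fin n → Fin K → ℝ) →ₗ[ℝ] EuclideanSpace ℝ (Fin n × Fin n) where
  toFun w := WithLp.toLp 2 fun p => if p.1 = p.2 then 0 else w p.1 (z p.2) + w p.2 (z p.1)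
  map_add' w w' := by
    ext p
    by_cases h : p.1 = p.2 <;> simp [h]
    ring
  map_smul' a w := by
    ext p
    by_cases h : p.1 = p.2 <;> simp [h]
    ring

/-- The linear space of noise-free networks with respect to the clustering `z`. -/
noncomputable def noiseFreeForms (z : Fin n → Fin K) :
    Submodule ℝ (EuclideanSpace ℝ (Fin n × Fin n)) :=
  LinearMap.range (sociabilityMap z)

theorem finrank_noiseFreeForms_le (z : Fin n → Fin K) :
    Module.finrank ℝ (noiseFreeForms z) ≤ n * K := by
  refine (LinearMap.finrank_range_le _).trans (le_of_eq ?_)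
  rw [Module.finrank_pi_fintype]
  simp

/-- Sociabilities may depend on the pair of clusters, so they can absorb `α` and, by symmetry, half
of `γ` at each end of the edge; this makes the nonlinear family linear. -/
theorem isNoiseFreeForm_iff (z : Fin n → Fin K) (P : Matrix (Fin n) (Fin n) ℝ) :
    IsNoiseFreeForm z P ↔ matrixVec P ∈ noiseFreeForms z := by
  constructor
  · rintro ⟨γ, α, β, Z, hγ, hβ, hP⟩
    refine ⟨fun u l => γ (z u) l / 2 + α (z u) l * Z u l, ?_⟩
    ext p
    rw [matrixVec_apply, hP]
    by_cases h : p.1 = p.2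
    · simp [sociabilityMap, h]
    · simp only [sociabilityMap, LinearMap.coe_mk, AddHom.coe_mk, h, if_false]
      rw [hβ, hγ (z p.2)]
      ring
  · rintro ⟨w, hw⟩
    refine ⟨fun _ _ => 0, fun _ _ => 1, fun _ _ => 1, w, fun _ _ => rfl, fun _ _ => rfl, ?_⟩
    intro u v
    rw [← matrixVec_apply P (u, v), ← hw]
    simp [sociabilityMap]

theorem isInducedEstimate_iff (A : Matrix (Fin n) (Fin n) ℝ) (z : Fin n → Fin K)
    (P : Matrix (Fin n) (Fin n) ℝ) :
    IsInducedEstimate A z P ↔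
      matrixVec P = (noiseFreeForms z).starProjection (matrixVec A) := by
  set V := noiseFreeForms z
  set a := matrixVec A
  have hpyth : ∀ q ∈ V, ‖a - q‖ ^ 2 = ‖a - V.starProjection a‖ ^ 2
      + ‖V.starProjection a - q‖ ^ 2 := by
    intro q hq
    have h0 := V.starProjection_inner_eq_zero a (V.starProjection a - q)
      (V.sub_mem (V.starProjection_apply_mem a) hq)
    rw [← sub_add_sub_cancel a (V.starProjection a) q, norm_add_sq_real, h0]
    ring
  constructor
  · rintro ⟨hP, hmin⟩
    rw [isNoiseFreeForm_iff] at hP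
    have h1 := hmin (matrixVec.symm (V.starProjection a)) (by
      rw [isNoiseFreeForm_iff, LinearEquiv.apply_symm_apply]
      exact V.starProjection_apply_mem a)
    rw [← norm_matrixVec_sub, ← norm_matrixVec_sub, LinearEquiv.apply_symm_apply] at h1
    have h2 := hpyth _ hP
    have h3 := pow_le_pow_left₀ (norm_nonneg _) h1 2
    have h4 : ‖V.starProjection a - matrixVec P‖ ^ 2 ≤ 0 := by linarith
    have h5 : ‖V.starProjection a - matrixVec P‖ = 0 := by
      nlinarith [norm_nonneg (V.starProjection a - matrixVec P)]
    exact (sub_eq_zero.1 (norm_eq_zero.1 h5)).symm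
  · intro hP
    refine ⟨?_, fun Q hQ => ?_⟩
    · rw [isNoiseFreeForm_iff, hP]
      exact V.starProjection_apply_mem a
    · rw [isNoiseFreeForm_iff] at hQ
      rw [← norm_matrixVec_sub, ← norm_matrixVec_sub, hP]
      have := hpyth _ hQ
      exact (sq_le_sq₀ (norm_nonneg _) (norm_nonneg _)).1
        (by nlinarith [sq_nonneg ‖V.starProjection a - matrixVec Q‖])

theorem exists_isInducedEstimate (A : Matrix (Fin n) (Fin n) ℝ) (z : Fin n → Fin K) :
    ∃ P, IsInducedEstimate A z P :=
  ⟨matrixVec.symm ((noiseFreeForms z).starProjection (matrixVec A)), by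
    rw [isInducedEstimate_iff, LinearEquiv.apply_symm_apply]⟩

theorem IsInducedEstimate.unique {A : Matrix (Fin n) (Fin n) ℝ} {z : Fin n → Fin K}
    {P Q : Matrix (Fin n) (Fin n) ℝ} (hP : IsInducedEstimate A z P)
    (hQ : IsInducedEstimate A z Q) : P = Q := by
  rw [isInducedEstimate_iff] at hP hQ
  exact matrixVec.injective (hP.trans hQ.symm)

theorem le_of_surjective {z : Fin n → Fin K} (hz : Function.Surjective z) : K ≤ n := by
  simpa using Fintype.card_le_of_surjective z hz

theorem exists_isPenalizedEstimate (pen : ℕ → ℝ) (A : Matrix (Fin n) (Fin n) ℝ) :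
    ∃ (K : ℕ) (z : Fin n → Fin K) (P : Matrix (Fin n) (Fin n) ℝ),
      IsPenalizedEstimate pen A K z P := by
  choose P hP using fun (K : ℕ) (z : Fin n → Fin K) => exists_isInducedEstimate A z
  -- Nonempty clusters force `K ≤ n`, so the minimum is over a finite set; it is nonempty because of
  -- the clustering into singletons.
  let ι := Σ K : Fin (n + 1), {z : Fin n → Fin K // Function.Surjective z}
  have : Nonempty ι := ⟨⟨⟨n, Nat.lt_succ_self n⟩, ⟨id, Function.surjective_id⟩⟩⟩
  obtain ⟨⟨K, z, hz⟩, hmin⟩ := Finite.exists_min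
    (fun i : ι => ‖A - P i.1 i.2.1‖ ^ 2 + pen i.1)
  refine ⟨K, z, P K z, hz, hP K z, fun K' z' P' hz' hP' => ?_⟩
  rw [hP'.unique (hP K' z')]
  exact hmin ⟨⟨K', Nat.lt_succ_of_le (le_of_surjective hz')⟩, ⟨z', hz'⟩⟩

/-- The error is `q - r` with `q = Πw` in `V` and `r` orthogonal to `V`. Expanding `‖w - (q - r)‖²`
and using `⟨w, q⟩ = ‖q‖²` gives the first bound; orthogonality gives the second. -/
theorem norm_sq_le_of_penalized {E : Type*} [NormedAddCommGroup E] [InnerProductSpace ℝ E]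
    (V : Submodule ℝ E) [V.HasOrthogonalProjection] {p w : E} {penHat penStar : ℝ}
    (h : ‖(p + w) - V.starProjection (p + w)‖ ^ 2 + penHat ≤ ‖(p + w) - p‖ ^ 2 + penStar) :
    ‖V.starProjection (p + w) - p‖ ^ 2 ≤ 2 * ‖V.starProjection w‖ ^ 2
        + 2 * |inner ℝ w (p - V.starProjection p)| + penStar - penHat ∧
      ‖p - V.starProjection p‖ ^ 2 ≤ ‖V.starProjection (p + w) - p‖ ^ 2 := by
  set r := p - V.starProjection p with hr
  set q := V.starProjection w with hq
  have hd : V.starProjection (p + w) - p = q - r := by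
    rw [map_add, hr, hq]; abel
  have hqV : q ∈ V := V.starProjection_apply_mem w
  have hrq : inner ℝ q r = 0 := by
    rw [real_inner_comm]
    exact V.starProjection_inner_eq_zero p q hqV
  have hwq : inner ℝ w q = ‖q‖ ^ 2 := by
    have h0 := V.starProjection_inner_eq_zero w q hqV
    rw [inner_sub_left, ← hq, real_inner_self_eq_norm_sq] at h0
    linarith
  have hres : (p + w) - V.starProjection (p + w) = w - (q - r) := by
    rw [← hd]; abel
  rw [hres, add_sub_cancel_left, norm_sub_sq_real, inner_sub_right, hwq] at h
  rw [hd]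
  refine ⟨?_, ?_⟩
  · have := neg_abs_le (inner ℝ w r)
    linarith
  · rw [norm_sub_sq_real q r, hrq]
    nlinarith [sq_nonneg ‖q‖]

end LinearAlgebra

/-! ### The noise of the model and its covariance. -/

namespace NormalLSM

variable {n K : ℕ} (θ : NormalLSM n K)

theorem sigma_sq_le_sigmaMaxSq {u v : Fin n} (h : u ≠ v) :
    θ.σ (θ.label u) (θ.label v) ^ 2 ≤ θ.sigmaMaxSq :=
  le_ciSup (f := fun e : {e : Fin n × Fin n // e.1 ≠ e.2} =>
    θ.σ (θ.label e.1.1) (θ.label e.1.2) ^ 2) (Set.finite_range _).bddAbove ⟨(u, v), h⟩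

theorem sigmaMaxSq_nonneg : 0 ≤ θ.sigmaMaxSq :=
  Real.iSup_nonneg fun _ => sq_nonneg _

/-- The effect of a unit error on the edge `e`. -/
noncomputable def edgeVec (e : {e : Sym2 (Fin n) // ¬ e.IsDiag}) :
    EuclideanSpace ℝ (Fin n × Fin n) :=
  WithLp.toLp 2 fun p => if s(p.1, p.2) = e.1 then θ.σ (θ.label p.1) (θ.label p.2) else 0

theorem matrixVec_network (Z : Fin n → ℝ) (ε : Sym2 (Fin n) → ℝ) :
    matrixVec (θ.network Z ε)
      = matrixVec (θ.noiseFree.network Z ε)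
        + ∑ e : {e : Sym2 (Fin n) // ¬ e.IsDiag}, ε e.1 • θ.edgeVec e := by
  ext ⟨u, v⟩
  rw [PiLp.add_apply, WithLp.ofLp_sum, Finset.sum_apply]
  simp only [matrixVec_apply, network, noiseFree, edgeVec, Matrix.of_apply, PiLp.smul_apply,
    smul_eq_mul, mul_ite, mul_zero, zero_mul, add_zero]
  by_cases h : u = v
  · subst h
    rw [if_pos rfl, if_pos rfl, zero_add]
    refine (Finset.sum_eq_zero fun e _ => if_neg fun he => e.2 ?_).symm
    rw [← he]
    exact Sym2.mk_isDiag_iff.2 rfl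
  · rw [if_neg h, if_neg h, Finset.sum_eq_single ⟨s(u, v), fun hd => h (Sym2.mk_isDiag_iff.1 hd)⟩]
    · simp [mul_comm]
    · intro e _ he
      refine if_neg fun h' => he (Subtype.ext h'.symm)
    · simp

/-- The factor `2` arises because an undirected edge fills two matrix entries (Cauchy–Schwarz on
them), while an entry belongs to at most one edge. -/
theorem sum_inner_edgeVec_sq_le (v : EuclideanSpace ℝ (Fin n × Fin n)) :
    ∑ e, inner ℝ (θ.edgeVec e) v ^ 2 ≤ 2 * θ.sigmaMaxSq * ‖v‖ ^ 2 := by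
  have hcard : ∀ e : Sym2 (Fin n),
      (Finset.univ.filter fun p : Fin n × Fin n => s(p.1, p.2) = e).card ≤ 2 := by
    intro e
    induction e using Sym2.ind with
    | _ a b =>
      refine (Finset.card_le_card (t := {(a, b), (b, a)}) ?_).trans Finset.card_le_two
      rintro ⟨c, d⟩ h
      simpa [Sym2.eq_iff] using h
  have h1 : ∀ e, inner ℝ (θ.edgeVec e) v ^ 2
      ≤ 2 * ∑ p : Fin n × Fin n, if s(p.1, p.2) = e.1 then θ.sigmaMaxSq * v p ^ 2 else 0 := by
    intro e
    have hin : inner ℝ (θ.edgeVec e) v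
        = ∑ p : Fin n × Fin n with s(p.1, p.2) = e.1,
          θ.σ (θ.label p.1) (θ.label p.2) * v p := by
      rw [PiLp.inner_apply, Finset.sum_filter]
      refine Finset.sum_congr rfl fun p _ => ?_
      by_cases h : s(p.1, p.2) = e.1 <;> simp [edgeVec, h, mul_comm]
    rw [hin, ← Finset.sum_filter]
    refine sq_sum_le_card_mul_sum_sq.trans (mul_le_mul (by exact_mod_cast hcard e.1) ?_
      (Finset.sum_nonneg fun _ _ => sq_nonneg _) zero_le_two)
    refine Finset.sum_le_sum fun p hp => ?_
    rw [mul_pow]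
    refine mul_le_mul_of_nonneg_right (θ.sigma_sq_le_sigmaMaxSq fun h => e.2 ?_) (sq_nonneg _)
    rw [← (Finset.mem_filter.1 hp).2]
    exact Sym2.mk_isDiag_iff.2 h
  refine (Finset.sum_le_sum fun e _ => h1 e).trans ?_
  rw [← Finset.mul_sum, Finset.sum_comm, mul_assoc, EuclideanSpace.norm_sq_eq,
    Finset.mul_sum _ _ θ.sigmaMaxSq]
  refine mul_le_mul_of_nonneg_left ?_ zero_le_two
  refine Finset.sum_le_sum fun p _ => ?_
  rw [← Finset.sum_filter, Finset.sum_const, nsmul_eq_mul, Real.norm_eq_abs, sq_abs]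
  have hc : (Finset.univ.filter
      fun e : {e : Sym2 (Fin n) // ¬ e.IsDiag} => s(p.1, p.2) = e.1).card ≤ 1 := by
    refine Finset.card_le_one.2 fun a ha b hb => Subtype.ext ?_
    rw [← (Finset.mem_filter.1 ha).2, ← (Finset.mem_filter.1 hb).2]
  refine mul_le_of_le_one_left (mul_nonneg θ.sigmaMaxSq_nonneg (sq_nonneg _)) ?_
  exact_mod_cast hc

theorem isNoiseFreeForm_noiseFree_network (Z : Fin n → ℝ) (ε : Sym2 (Fin n) → ℝ) :
    IsNoiseFreeForm θ.label (θ.noiseFree.network Z ε) :=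
  ⟨θ.γ, θ.α, θ.β, fun u _ => Z u, θ.γ_symm, θ.β_eq, fun u v => by
    simp [network, noiseFree]⟩

theorem noiseFree_network_eq (Z : Fin n → ℝ) (ε ε' : Sym2 (Fin n) → ℝ) :
    θ.noiseFree.network Z ε = θ.noiseFree.network Z ε' := by
  simp [network, noiseFree]

theorem continuous_matrixVec_noiseFree_network (ε : Sym2 (Fin n) → ℝ) :
    Continuous fun Z => matrixVec (θ.noiseFree.network Z ε) := by
  refine (PiLp.continuous_toLp 2 _).comp (continuous_pi fun p => ?_)
  simp only [network, Matrix.of_apply]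
  split_ifs <;> fun_prop

end NormalLSM

/-- Moves probabilities to a product measure, where conditioning on the sociabilities is Fubini's
theorem. -/
theorem IsStandardNormalInput.measure_preimage {Ω : Type*} [MeasurableSpace Ω] {μ : Measure Ω}
    [IsProbabilityMeasure μ] {n : ℕ} {Z : Fin n → Ω → ℝ} {ε : Sym2 (Fin n) → Ω → ℝ}
    (h : IsStandardNormalInput μ Z ε)
    {S : Set ((Fin n → ℝ) × ({e : Sym2 (Fin n) // ¬ e.IsDiag} → ℝ))} (hS : MeasurableSet S) :
    μ {ω | ((fun u => Z u ω), (fun e : {e : Sym2 (Fin n) // ¬ e.IsDiag} => ε e.1 ω)) ∈ S}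
      = ((stdGaussianPi (Fin n)).prod (stdGaussianPi {e : Sym2 (Fin n) // ¬ e.IsDiag})) S := by
  set X := Sum.elim Z (fun e : {e : Sym2 (Fin n) // ¬ e.IsDiag} => ε e.1) with hX
  have hlaw : ∀ i, HasLaw (X i) (gaussianReal 0 1) μ := by
    rintro (u | e)
    · exact h.law_Z u
    · exact h.law_ε e.1 e.2
  have hm : ∀ i, AEMeasurable (X i) μ := fun i => (hlaw i).aemeasurable
  have hmap := (iIndepFun_iff_map_fun_eq_pi_map hm).1 h.indep
  simp_rw [fun i => (hlaw i).map_eq] at hmap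
  have hp := measurePreserving_sumPiEquivProdPi
    (X := fun _ : Fin n ⊕ {e : Sym2 (Fin n) // ¬ e.IsDiag} => ℝ) (fun _ => gaussianReal 0 1)
  rw [← hp.measure_preimage hS.nullMeasurableSet, ← hmap,
    Measure.map_apply_of_aemeasurable (aemeasurable_pi_lambda _ hm) (hp.measurable hS)]
  rfl

/-! ### Arithmetic of the penalty. -/

theorem penalty_nonneg {C₁ C₂ C₃ c s : ℝ} (h₁ : 0 ≤ C₁) (h₂ : 0 ≤ C₂) (h₃ : 0 ≤ C₃) (hc : 0 < c)
    (hs : 0 ≤ s) (n K : ℕ) : 0 ≤ penalty C₁ C₂ C₃ c s n K := by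
  have := Real.log_natCast_nonneg n
  have := Real.log_natCast_nonneg K
  unfold penalty
  positivity

/-- Here `D` is the error, `q` the squared projected noise, `g` the noise along the bias and `r` the
norm of the bias. The `C₁` term of the penalty pays for the dimension, the last term for the
logarithm of the number of clusterings. -/
theorem penalized_risk_bound {c s t C₁ C₂ C₃ D q g r penStar : ℝ} {n K : ℕ}
    (hc : 0 < c) (hc1 : c < 1) (hs : 0 < s) (ht : 0 < t) (h₁ : 48 ≤ C₁) (h₂ : 48 ≤ C₂)
    (h₃ : 48 / c ≤ C₃) (hpen : 0 ≤ penStar)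
    (hD : D ^ 2 ≤ 2 * q + 2 * g + penStar - penalty C₁ C₂ C₃ c s n K) (hr : r ^ 2 ≤ D ^ 2)
    (hq : q ≤ 8 * s * (n * K / 2 + (Real.log n + n * Real.log K + t)))
    (hg : g ≤ √(4 * s * (Real.log n + n * Real.log K + t)) * r) :
    D ^ 2 ≤ (1 - c)⁻¹ * penStar + 48 / c * s * t := by
  have hl := Real.log_natCast_nonneg n
  have hl' := Real.log_natCast_nonneg K
  have hx0 : 0 ≤ Real.log n + n * Real.log K := by positivity
  have hpenK : 8 * s * (n * K) + 24 * s * (Real.log n + n * Real.log K) / c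
      ≤ penalty C₁ C₂ C₃ c s n K := by
    have e1 : 8 * s * (n * K : ℝ) ≤ 6 * s * (C₁ * n * K) := by
      have : 48 * (n * K : ℝ) ≤ C₁ * (n * K) := by gcongr
      nlinarith [show (0 : ℝ) ≤ s * (n * K) by positivity]
    have e2 : 0 ≤ 6 * s * (C₂ * (K : ℝ) ^ 2 * Real.log n) := by
      have : 0 ≤ C₂ := by linarith
      positivity
    have e3 : 24 * s * (Real.log n + n * Real.log K) / c
        ≤ (6 * C₃ + 2 / c) * s * (Real.log n + n * Real.log K) := by
      have h24 : 24 / c ≤ 6 * C₃ + 2 / c := by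
        have : 24 / c ≤ 48 / c := by gcongr; norm_num
        have : 0 < 2 / c := by positivity
        have : 0 < 48 / c := by positivity
        linarith
      calc 24 * s * (Real.log n + n * Real.log K) / c
          = 24 / c * s * (Real.log n + n * Real.log K) := by ring
        _ ≤ _ := by gcongr
    unfold penalty
    linarith
  generalize hx : Real.log n + n * Real.log K = x at *
  generalize penalty C₁ C₂ C₃ c s n K = penHat at *
  set b := √(4 * s * (x + t))
  have hb : b ^ 2 = 4 * s * (x + t) := Real.sq_sqrt (by positivity)
  -- Young's parameter `a = min c (1/2)` keeps `(1 - a)⁻¹` below both `(1 - c)⁻¹`, for the penalty,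
  -- and `2`, for the `t` term (hence `48 = 2 * 24`), while `a ≥ c / 2` controls `b² / a`.
  have hac : min c (1 / 2) ≤ c := min_le_left _ _
  have hah : min c (1 / 2) ≤ 1 / 2 := min_le_right _ _
  have ha : c / 2 ≤ min c (1 / 2) := le_min (by linarith) (by linarith)
  generalize min c (1 / 2) = a at hac hah ha
  have ha0 : 0 < a := by linarith
  have hyoung : 2 * (b * r) ≤ a * r ^ 2 + b ^ 2 / a := by
    have : a * r ^ 2 + b ^ 2 / a - 2 * (b * r) = (a * r - b) ^ 2 / a := by
      field_simp
      ring
    have : 0 ≤ (a * r - b) ^ 2 / a := by positivity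
    linarith
  have hba : b ^ 2 / a ≤ 8 * s * (x + t) / c := by
    rw [hb]
    calc 4 * s * (x + t) / a ≤ 4 * s * (x + t) / (c / 2) := by gcongr
      _ = _ := by field_simp; norm_num
  have hxc : 16 * s * (x + t) ≤ 16 * s * (x + t) / c := by
    rw [le_div_iff₀ hc]
    nlinarith [show 0 ≤ 16 * s * (x + t) by positivity]
  have har : a * r ^ 2 ≤ a * D ^ 2 := by gcongr
  have hsplit : 8 * s * (x + t) / c + 16 * s * (x + t) / c = 24 * s * x / c + 24 * s * t / c := by
    ring
  have hmain : D ^ 2 * (1 - a) ≤ penStar + 24 * s * t / c := by linarith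
  have h1a : 0 < 1 - a := by linarith
  calc D ^ 2 ≤ (penStar + 24 * s * t / c) / (1 - a) := by rwa [le_div_iff₀ h1a]
    _ = (1 - a)⁻¹ * penStar + (1 - a)⁻¹ * (24 * s * t / c) := by ring
    _ ≤ (1 - c)⁻¹ * penStar + 2 * (24 * s * t / c) := by
      have : (1 - a)⁻¹ ≤ 2 := by
        rw [inv_le_comm₀ h1a two_pos]
        linarith
      have : 0 < 1 - c := by linarith
      gcongr
    _ = _ := by ring

/-! ### Union bound over clusterings and the risk bound on the good event. -/

namespace NormalLSM

variable {n Kstar : ℕ} (θ : NormalLSM n Kstar)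

/-- The part of the noise-free network that the clustering `z` cannot represent. -/
noncomputable def bias {K : ℕ} (z : Fin n → Fin K) (Z : Fin n → ℝ) :
    EuclideanSpace ℝ (Fin n × Fin n) :=
  matrixVec (θ.noiseFree.network Z 0)
    - (noiseFreeForms z).starProjection (matrixVec (θ.noiseFree.network Z 0))

theorem continuous_bias {K : ℕ} (z : Fin n → Fin K) : Continuous (θ.bias z) :=
  (θ.continuous_matrixVec_noiseFree_network 0).sub
    ((noiseFreeForms z).starProjection.continuous.comp
      (θ.continuous_matrixVec_noiseFree_network 0))

/-- The inputs for which the noise deviates too much for the clustering `z`: either its projection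
on the noise-free networks is large, or its component along the bias is. -/
def deviationSet {K : ℕ} (z : Fin n → Fin K) (x : ℝ) :
    Set ((Fin n → ℝ) × ({e : Sym2 (Fin n) // ¬ e.IsDiag} → ℝ)) :=
  {p | 4 * (2 * θ.sigmaMaxSq)
        * (Module.finrank ℝ (noiseFreeForms z) * (Real.log 2 / 2) + x)
      ≤ ‖(noiseFreeForms z).starProjection (∑ e, p.2 e • θ.edgeVec e)‖ ^ 2} ∪
  {p | √(2 * (2 * θ.sigmaMaxSq) * x) * ‖θ.bias z p.1‖
      < |inner ℝ (∑ e, p.2 e • θ.edgeVec e) (θ.bias z p.1)|}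

theorem measurableSet_deviationSet {K : ℕ} (z : Fin n → Fin K) (x : ℝ) :
    MeasurableSet (θ.deviationSet z x) := by
  have hc : Continuous fun p : (Fin n → ℝ) × ({e : Sym2 (Fin n) // ¬ e.IsDiag} → ℝ) =>
      ∑ e, p.2 e • θ.edgeVec e := by fun_prop
  have hb : Continuous fun p : (Fin n → ℝ) × ({e : Sym2 (Fin n) // ¬ e.IsDiag} → ℝ) =>
      θ.bias z p.1 := (θ.continuous_bias z).comp continuous_fst
  refine (IsClosed.measurableSet (isClosed_le (by fun_prop) (by fun_prop))).union
    (IsOpen.measurableSet (isOpen_lt (by fun_prop) (by fun_prop)))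

/-- For fixed sociabilities the bias is a fixed vector, so both Gaussian tails apply to the section:
`1 + 2 = 3`. -/
theorem measure_deviationSet_le (hs : 0 < θ.sigmaMaxSq) {K : ℕ} (z : Fin n → Fin K) {x : ℝ}
    (hx : 0 < x) :
    ((stdGaussianPi (Fin n)).prod (stdGaussianPi {e : Sym2 (Fin n) // ¬ e.IsDiag}))
      (θ.deviationSet z x) ≤ 3 * ENNReal.ofReal (Real.exp (-x)) := by
  rw [Measure.prod_apply (θ.measurableSet_deviationSet z x)]
  refine (lintegral_mono (g := fun _ => 3 * ENNReal.ofReal (Real.exp (-x))) fun a => ?_).trans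
    (by simp)
  have h1 := stdGaussianPi_starProjection_tail θ.sum_inner_edgeVec_sq_le (by positivity)
    (noiseFreeForms z) x
  have h2 := stdGaussianPi_inner_tail θ.sum_inner_edgeVec_sq_le (by positivity) hx (θ.bias z a)
  refine (measure_union_le _ _).trans ((add_le_add h1 h2).trans (le_of_eq ?_))
  ring

/-- With `K = i + 1` running over `1, …, n`, the level makes each of the `K ^ n` labelings cost `3
exp (-t) / (n K ^ n)`. -/
theorem measure_iUnion_deviationSet_le (hs : 0 < θ.sigmaMaxSq) {t : ℝ} (ht : 0 < t) :
    ((stdGaussianPi (Fin n)).prod (stdGaussianPi {e : Sym2 (Fin n) // ¬ e.IsDiag}))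
      (⋃ (i : Fin n) (z : Fin n → Fin (i + 1)),
        θ.deviationSet z (Real.log n + n * Real.log ((i + 1 : ℕ) : ℝ) + t))
      ≤ ENNReal.ofReal (3 * Real.exp (-t)) := by
  rcases Nat.eq_zero_or_pos n with rfl | hn
  · simp
  have hn' : (0 : ℝ) < n := by exact_mod_cast hn
  have hterm : ∀ i : Fin n,
      ((stdGaussianPi (Fin n)).prod (stdGaussianPi {e : Sym2 (Fin n) // ¬ e.IsDiag}))
        (⋃ z : Fin n → Fin (i + 1),
          θ.deviationSet z (Real.log n + n * Real.log ((i + 1 : ℕ) : ℝ) + t))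
        ≤ ENNReal.ofReal (3 * Real.exp (-t) / n) := by
    intro i
    have hx : 0 < Real.log n + n * Real.log ((i + 1 : ℕ) : ℝ) + t := by
      have := Real.log_natCast_nonneg n
      have := Real.log_natCast_nonneg (i + 1)
      positivity
    refine (measure_iUnion_fintype_le _ _).trans
      ((Finset.sum_le_sum fun z _ => θ.measure_deviationSet_le hs z hx).trans (le_of_eq ?_))
    rw [Finset.sum_const, Finset.card_univ, nsmul_eq_mul, Fintype.card_fun, Fintype.card_fin,
      Fintype.card_fin, ← ENNReal.ofReal_natCast, ← ENNReal.ofReal_ofNat,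
      ← ENNReal.ofReal_mul (by norm_num), ← ENNReal.ofReal_mul (by positivity)]
    congr 1
    have hK : (0 : ℝ) < ((i + 1 : ℕ) : ℝ) := by positivity
    rw [neg_add, neg_add, Real.exp_add, Real.exp_add, Real.exp_neg (Real.log n),
      Real.exp_log hn', Real.exp_neg (n * _), Real.exp_nat_mul, Real.exp_log hK, Nat.cast_pow]
    field_simp
  refine (measure_iUnion_fintype_le _ _).trans
    ((Finset.sum_le_sum fun i _ => hterm i).trans (le_of_eq ?_))
  rw [Finset.sum_const, Finset.card_univ, Fintype.card_fin, nsmul_eq_mul,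
    ← ENNReal.ofReal_natCast, ← ENNReal.ofReal_mul hn'.le]
  congr 1
  field_simp

/-- The comparison of a penalized estimate with the noise-free network itself. -/
theorem norm_sq_sub_add_le {pen : ℕ → ℝ} {Z : Fin n → ℝ} {ε : Sym2 (Fin n) → ℝ} {K : ℕ}
    {z : Fin n → Fin K} {P : Matrix (Fin n) (Fin n) ℝ}
    (h : IsPenalizedEstimate pen (θ.network Z ε) K z P) :
    ‖θ.network Z ε - P‖ ^ 2 + pen K
      ≤ ‖θ.network Z ε - θ.noiseFree.network Z ε‖ ^ 2 + pen Kstar := by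
  -- The true labels are a competitor, and their induced estimate fits at least as well as the
  -- noise-free network.
  obtain ⟨Q, hQ⟩ := exists_isInducedEstimate (θ.network Z ε) θ.label
  have h1 := h.2.2 Kstar θ.label Q θ.label_surjective hQ
  have h2 := hQ.2 _ (θ.isNoiseFreeForm_noiseFree_network Z ε)
  have h3 := pow_le_pow_left₀ (norm_nonneg _) h2 2
  linarith

theorem network_eq_noiseFree_of_sigmaMaxSq_eq_zero (hs : θ.sigmaMaxSq = 0) (Z : Fin n → ℝ)
    (ε : Sym2 (Fin n) → ℝ) : θ.network Z ε = θ.noiseFree.network Z ε := by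
  ext u v
  by_cases h : u = v
  · simp [network, h]
  · have h0 : θ.σ (θ.label u) (θ.label v) = 0 := by
      have := θ.sigma_sq_le_sigmaMaxSq h
      rw [hs] at this
      exact pow_eq_zero_iff two_ne_zero |>.1 (le_antisymm this (sq_nonneg _))
    simp [network, noiseFree, h, h0]

/-- The risk bound, on the event that no clustering deviates. -/
theorem norm_sq_le_of_forall_notMem_deviationSet {C₁ C₂ C₃ c t : ℝ} {pen : ℕ → ℝ}
    (h₁ : 48 ≤ C₁) (h₂ : 48 ≤ C₂) (hc : 0 < c) (hc1 : c < 1) (h₃ : 48 / c ≤ C₃)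
    (hpen : ∀ K, pen K = penalty C₁ C₂ C₃ c θ.sigmaMaxSq n K) (hs : 0 < θ.sigmaMaxSq) (ht : 0 < t)
    {Z : Fin n → ℝ} {ε : Sym2 (Fin n) → ℝ}
    (hdev : ∀ (i : Fin n) (z : Fin n → Fin (i + 1)), (Z, fun e => ε e.1) ∉
      θ.deviationSet z (Real.log n + n * Real.log ((i + 1 : ℕ) : ℝ) + t))
    {K : ℕ} {z : Fin n → Fin K} {P : Matrix (Fin n) (Fin n) ℝ}
    (h : IsPenalizedEstimate pen (θ.network Z ε) K z P) :
    ‖P - θ.noiseFree.network Z ε‖ ^ 2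
      ≤ (1 - c)⁻¹ * pen Kstar + 48 / c * θ.sigmaMaxSq * t := by
  have hn : 0 < n := by
    rcases Nat.eq_zero_or_pos n with rfl | hn
    · have : IsEmpty {e : Fin 0 × Fin 0 // e.1 ≠ e.2} := inferInstance
      simp [sigmaMaxSq] at hs
    · exact hn
  have hK : 0 < K := (Nat.zero_le _).trans_lt (z ⟨0, hn⟩).2
  obtain ⟨j, rfl⟩ : ∃ j, K = j + 1 := ⟨K - 1, by omega⟩
  have hj : j < n := le_of_surjective h.1
  have hnot := hdev ⟨j, hj⟩ z
  simp only [deviationSet, Set.mem_union, Set.mem_ofPred_eq, not_or, not_le, not_lt] at hnot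
  obtain ⟨hq, hg⟩ := hnot
  have hcmp := θ.norm_sq_sub_add_le h
  have hP := (isInducedEstimate_iff _ _ _).1 h.2.1
  rw [← norm_matrixVec_sub, ← norm_matrixVec_sub, hP, θ.matrixVec_network] at hcmp
  obtain ⟨hD, hr⟩ := norm_sq_le_of_penalized (noiseFreeForms z) hcmp
  rw [← norm_matrixVec_sub, hP, θ.matrixVec_network]
  rw [hpen (j + 1)] at hD
  have hb : matrixVec (θ.noiseFree.network Z ε)
      - (noiseFreeForms z).starProjection (matrixVec (θ.noiseFree.network Z ε)) = θ.bias z Z := by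
    rw [bias, θ.noiseFree_network_eq Z ε 0]
  rw [hb] at hD hr
  refine penalized_risk_bound (n := n) (K := j + 1) hc hc1 hs ht h₁ h₂ h₃ ?_ hD hr
    (hq.le.trans ?_) (hg.trans (le_of_eq ?_))
  · rw [hpen]
    have : 0 < 48 / c := by positivity
    exact penalty_nonneg (by linarith) (by linarith) (by linarith) hc hs.le n Kstar
  · have hfin : (Module.finrank ℝ (noiseFreeForms z) : ℝ) ≤ n * ((j + 1 : ℕ) : ℝ) := by
      exact_mod_cast finrank_noiseFreeForms_le z
    have hlog : Real.log 2 / 2 ≤ 1 / 2 := by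
      have := Real.log_two_lt_d9
      linarith
    have hprod : (Module.finrank ℝ (noiseFreeForms z) : ℝ) * (Real.log 2 / 2)
        ≤ n * ((j + 1 : ℕ) : ℝ) * (1 / 2) := by
      have := Real.log_pos one_lt_two
      gcongr
    rw [show 4 * (2 * θ.sigmaMaxSq) = 8 * θ.sigmaMaxSq by ring]
    gcongr
    linarith
  · congr 2
    ring

end NormalLSM

/-! ### The main theorem. -/

theorem theorem1 :
    ∃ C₀ : ℝ, 0 < C₀ ∧
      ∀ C₁ C₂ C₃ c : ℝ, C₀ ≤ C₁ → C₀ ≤ C₂ → 0 < c → c < 1 → C₀ / c ≤ C₃ →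
      ∀ (n Kstar : ℕ) (θ : NormalLSM n Kstar)
        (Ω : Type*) [MeasurableSpace Ω] (μ : Measure Ω) [IsProbabilityMeasure μ]
        (Z : Fin n → Ω → ℝ) (ε : Sym2 (Fin n) → Ω → ℝ)
        (A Pstar : Ω → Matrix (Fin n) (Fin n) ℝ) (pen : ℕ → ℝ),
        IsStandardNormalInput μ Z ε →
        (∀ ω, A ω = θ.network (fun u => Z u ω) (fun e => ε e ω)) →
        (∀ ω, Pstar ω = θ.noiseFree.network (fun u => Z u ω) (fun e => ε e ω)) →
        (∀ K, pen K = penalty C₁ C₂ C₃ c θ.sigmaMaxSq n K) →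
        (∀ ω, ∃ (Khat : ℕ) (zhat : Fin n → Fin Khat) (Phat : Matrix (Fin n) (Fin n) ℝ),
          IsPenalizedEstimate pen (A ω) Khat zhat Phat) ∧
        ∀ t : ℝ, 0 < t →
          ∃ E : Set Ω, MeasurableSet E ∧ 1 - 3 * Real.exp (-t) ≤ μ.real E ∧
            ∀ ω ∈ E, ∀ (Khat : ℕ) (zhat : Fin n → Fin Khat) (Phat : Matrix (Fin n) (Fin n) ℝ),
              IsPenalizedEstimate pen (A ω) Khat zhat Phat →
                ‖Phat - Pstar ω‖ ^ 2
                  ≤ (1 - c)⁻¹ * pen Kstar + C₀ / c * θ.sigmaMaxSq * t := by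
  refine ⟨48, by norm_num, ?_⟩
  intro C₁ C₂ C₃ c h₁ h₂ hc hc1 h₃ n Kstar θ Ω _ μ _ Z ε A Pstar pen hin hA hP hpen
  refine ⟨fun ω => exists_isPenalizedEstimate pen (A ω), fun t ht => ?_⟩
  -- Without noise the penalty vanishes and the estimate recovers the network exactly; the tail
  -- bounds need positive variance.
  rcases θ.sigmaMaxSq_nonneg.eq_or_lt with hs | hs
  · refine ⟨Set.univ, MeasurableSet.univ, ?_, fun ω _ K z P h => ?_⟩
    · rw [probReal_univ]
      linarith [Real.exp_pos (-t)]
    · rw [hA] at h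
      have hcmp := θ.norm_sq_sub_add_le h
      have hpen0 : ∀ K, pen K = 0 := fun K => by rw [hpen, ← hs]; simp [penalty]
      rw [hpen0, hpen0, θ.network_eq_noiseFree_of_sigmaMaxSq_eq_zero hs.symm, sub_self,
        norm_sub_rev, ← hP] at hcmp
      rw [hpen0, ← hs]
      simpa using hcmp
  · set B := ⋃ (i : Fin n) (z : Fin n → Fin (i + 1)),
      θ.deviationSet z (Real.log n + n * Real.log ((i + 1 : ℕ) : ℝ) + t)
    have hB : MeasurableSet B := MeasurableSet.iUnion fun i => MeasurableSet.iUnion fun z =>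
      θ.measurableSet_deviationSet z _
    set F := {ω | ((fun u => Z u ω),
      (fun e : {e : Sym2 (Fin n) // ¬ e.IsDiag} => ε e.1 ω)) ∈ B} with hF
    have hμF : μ F ≤ ENNReal.ofReal (3 * Real.exp (-t)) := by
      rw [hF, hin.measure_preimage hB]
      exact θ.measure_iUnion_deviationSet_le hs ht
    -- The inputs are only almost everywhere measurable, so `F` is replaced by a measurable hull of
    -- the same measure.
    refine ⟨(toMeasurable μ F)ᶜ, (measurableSet_toMeasurable μ F).compl, ?_,
      fun ω hω K z P h => ?_⟩
    · rw [probReal_compl_eq_one_sub (measurableSet_toMeasurable μ F), measureReal_def,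
        measure_toMeasurable]
      have := ENNReal.toReal_le_of_le_ofReal (by positivity) hμF
      linarith
    · rw [hA] at h
      rw [hP]
      refine θ.norm_sq_le_of_forall_notMem_deviationSet h₁ h₂ hc hc1 h₃ hpen hs ht
        (fun i z' hmem => hω (subset_toMeasurable μ F ?_)) h
      exact Set.mem_iUnion.2 ⟨i, Set.mem_iUnion.2 ⟨z', hmem⟩⟩
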